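/- Let $\mathbb{F}$ be a field. A Leibniz algebra over $\mathbb{F}$ is an $\mathbb{F}$-vector space with a bilinear product satisfying $x(yz)=(xy)z+y(xz)$. For subspaces $A,B$ write $AB$ for the span of all products $ab$ ($a\in A$, $b\in B$), $L'=LL$, and $Z(L)=\{z : zx=xz=0 \text{ for all } x\in L\}$. Let $\mathcal{H}^2(L,\mathbb{F})=\mathcal{Z}^2(L,\mathbb{F})/\mathcal{B}^2(L,\mathbb{F})$, where $\mathcal{Z}^2(L,\mathbb{F})$ is the space of bilinear forms $f:L\times L\to\mathbb{F}$ with $f(x,yz)=f(xy,z)+f(y,xz)$ for all $x,y,z\in L$, and $\mathcal{B}^2(L,\mathbb{F})$ is the subspace of the forms $(x,y)\mapsto-\varepsilon(xy)$ with $\varepsilon:L\to\mathbb{F}$ linear. A defining pair for $L$ is a pair $(K,M)$ of a Leibniz algebra $K$ and an ideal $M$ of $K$ such that $L\cong K/M$ and $M\subseteq Z(K)\cap K'$; it is maximal if $\dim K$ is the largest possible among defining pairs for $L$, and then $M$ is called the multiplier $M(L)$ of $L$. Theorem. Let $L$ be a Leibniz algebra over $\mathbb{F}$, let $0\to R\to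 F\to L\to 0$ be a free presentation of $L$ (that is, $F$ is a free Leibniz algebra and $R$ is the kernel of a surjective homomorphism $F\to L$), and put $D=(F'\cap R)/(FR+RF)$. 1. $\mathcal{H}^2(L,\mathbb{F})\cong\operatorname{Hom}_{\mathbb{F}}(D,\mathbb{F})$ as vector spaces. In particular, if $D$ is finite-dimensional, then $$\mathcal{H}^2(L,\mathbb{F})\cong\frac{F'\cap R}{FR+RF}.$$ 2. If $L$ is finite-dimensional, then $\mathcal{H}^2(L,\mathbb{F})\cong\frac{F'\cap R}{FR+RF}$; moreover a maximal defining pair for $L$ exists, and for every maximal defining pair $(K,M)$ one has $M\cong\mathcal{H}^2(L,\mathbb{F})$, i.e. $M(L)\cong\mathcal{H}^2(L,\mathbb{F})$. -/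

import Mathlib

set_option maxSynthPendingDepth 3

/-! ### Leibniz algebras

Homomorphisms of Leibniz algebras over `k` are the multiplicative linear maps `A →ₙₐ[k] B`. -/

/-- A ring (not assumed associative or unital) whose product satisfies the (left) Leibniz
identity `x(yz) = (xy)z + y(xz)`. -/
class LeibnizRing (L : Type*) extends NonUnitalNonAssocRing L where
  leibniz : ∀ x y z : L, x * (y * z) = (x * y) * z + y * (x * z)

/-- A Leibniz algebra over `k`: a `k`-module with a `k`-bilinear product satisfying the Leibniz
identity. -/
class LeibnizAlgebra (k L : Type*) [CommRing k] [LeibnizRing L] extends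
  Module k L, IsScalarTower k L L, SMulCommClass k L L

/-! ### Free Leibniz algebras -/

noncomputable section Free

universe u v w

variable (k : Type u) [CommRing k] (X : Type v)

/-- The relation on the free nonassociative algebra on `X` which generates the congruence
imposing the Leibniz identity. -/
inductive FreeLeibnizRel :
    FreeNonUnitalNonAssocAlgebra k X → FreeNonUnitalNonAssocAlgebra k X → Prop
  | leibniz (a b c : FreeNonUnitalNonAssocAlgebra k X) :
      FreeLeibnizRel (a * (b * c)) ((a * b) * c + b * (a * c))
  | smul (t : k) {a b : FreeNonUnitalNonAssocAlgebra k X} :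
      FreeLeibnizRel a b → FreeLeibnizRel (t • a) (t • b)
  | add_right {a b : FreeNonUnitalNonAssocAlgebra k X} (c : FreeNonUnitalNonAssocAlgebra k X) :
      FreeLeibnizRel a b → FreeLeibnizRel (a + c) (b + c)
  | mul_left (a : FreeNonUnitalNonAssocAlgebra k X) {b c : FreeNonUnitalNonAssocAlgebra k X} :
      FreeLeibnizRel b c → FreeLeibnizRel (a * b) (a * c)
  | mul_right {a b : FreeNonUnitalNonAssocAlgebra k X} (c : FreeNonUnitalNonAssocAlgebra k X) :
      FreeLeibnizRel a b → FreeLeibnizRel (a * c) (b * c)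

/-- The free Leibniz algebra over `k` on the set `X`. -/
def FreeLeibnizAlgebra := Quot (FreeLeibnizRel k X)

namespace FreeLeibnizAlgebra

variable {k X}

theorem rel_add_left (a : FreeNonUnitalNonAssocAlgebra k X)
    {b c : FreeNonUnitalNonAssocAlgebra k X} (h : FreeLeibnizRel k X b c) :
    FreeLeibnizRel k X (a + b) (a + c) := by
  rw [add_comm _ b, add_comm _ c]; exact h.add_right _

theorem rel_neg {a b : FreeNonUnitalNonAssocAlgebra k X} (h : FreeLeibnizRel k X a b) :
    FreeLeibnizRel k X (-a) (-b) := by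
  simpa only [neg_one_smul] using h.smul (-1)

instance : Zero (FreeLeibnizAlgebra k X) where zero := Quot.mk _ 0

instance : Add (FreeLeibnizAlgebra k X) where
  add := Quot.map₂ (· + ·) (fun _ _ _ => rel_add_left _) fun _ _ _ => FreeLeibnizRel.add_right _

instance : Neg (FreeLeibnizAlgebra k X) where neg := Quot.map Neg.neg fun _ _ => rel_neg

instance : SMul k (FreeLeibnizAlgebra k X) where
  smul t := Quot.map (t • ·) fun _ _ => FreeLeibnizRel.smul t

instance : Mul (FreeLeibnizAlgebra k X) where
  mul := Quot.map₂ (· * ·) (fun _ _ _ => FreeLeibnizRel.mul_left _)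
    fun _ _ _ => FreeLeibnizRel.mul_right _

instance : AddCommGroup (FreeLeibnizAlgebra k X) where
  add_assoc := by rintro ⟨a⟩ ⟨b⟩ ⟨c⟩; exact congrArg (Quot.mk _) (add_assoc a b c)
  zero_add := by rintro ⟨a⟩; exact congrArg (Quot.mk _) (zero_add a)
  add_zero := by rintro ⟨a⟩; exact congrArg (Quot.mk _) (add_zero a)
  nsmul := nsmulRec
  zsmul := zsmulRec
  neg_add_cancel := by rintro ⟨a⟩; exact congrArg (Quot.mk _) (neg_add_cancel a)
  add_comm := by rintro ⟨a⟩ ⟨b⟩; exact congrArg (Quot.mk _) (add_comm a b)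

instance : LeibnizRing (FreeLeibnizAlgebra k X) where
  left_distrib := by rintro ⟨a⟩ ⟨b⟩ ⟨c⟩; exact congrArg (Quot.mk _) (mul_add a b c)
  right_distrib := by rintro ⟨a⟩ ⟨b⟩ ⟨c⟩; exact congrArg (Quot.mk _) (add_mul a b c)
  zero_mul := by rintro ⟨a⟩; exact congrArg (Quot.mk _) (zero_mul a)
  mul_zero := by rintro ⟨a⟩; exact congrArg (Quot.mk _) (mul_zero a)
  leibniz := by rintro ⟨a⟩ ⟨b⟩ ⟨c⟩; exact Quot.sound (FreeLeibnizRel.leibniz a b c)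

instance : LeibnizAlgebra k (FreeLeibnizAlgebra k X) where
  one_smul := by rintro ⟨a⟩; exact congrArg (Quot.mk _) (one_smul k a)
  mul_smul := by rintro s t ⟨a⟩; exact congrArg (Quot.mk _) (mul_smul s t a)
  smul_zero := fun t => congrArg (Quot.mk _) (smul_zero t)
  smul_add := by rintro t ⟨a⟩ ⟨b⟩; exact congrArg (Quot.mk _) (smul_add t a b)
  add_smul := by rintro s t ⟨a⟩; exact congrArg (Quot.mk _) (add_smul s t a)
  zero_smul := by rintro ⟨a⟩; exact congrArg (Quot.mk _) (zero_smul k a)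
  smul_assoc := by rintro t ⟨a⟩ ⟨b⟩; exact congrArg (Quot.mk _) (smul_mul_assoc t a b)
  smul_comm := by rintro t ⟨a⟩ ⟨b⟩; exact congrArg (Quot.mk _) (mul_smul_comm t a b).symm

variable (k) in
/-- The generators of the free Leibniz algebra. -/
def of (x : X) : FreeLeibnizAlgebra k X := Quot.mk _ (FreeNonUnitalNonAssocAlgebra.of k x)

/-- The quotient map from the free nonassociative algebra. -/
def mk : FreeNonUnitalNonAssocAlgebra k X →ₙₐ[k] FreeLeibnizAlgebra k X where
  toFun := Quot.mk _
  map_smul' _ _ := rfl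
  map_zero' := rfl
  map_add' _ _ := rfl
  map_mul' _ _ := rfl

variable {A : Type w} [LeibnizRing A] [LeibnizAlgebra k A]

theorem lift_spec (f : X → A) (a b : FreeNonUnitalNonAssocAlgebra k X)
    (h : FreeLeibnizRel k X a b) :
    FreeNonUnitalNonAssocAlgebra.lift k f a = FreeNonUnitalNonAssocAlgebra.lift k f b := by
  induction h with
  | leibniz a b c => simp only [map_mul, map_add]; exact LeibnizRing.leibniz _ _ _
  | smul t _ h => simp only [map_smul, h]
  | add_right c _ h => simp only [map_add, h]
  | mul_left c _ h => simp only [map_mul, h]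
  | mul_right c _ h => simp only [map_mul, h]

variable (k) in
/-- The homomorphism from the free Leibniz algebra on `X` to a Leibniz algebra `A` induced by a
map `X → A`. -/
def lift (f : X → A) : FreeLeibnizAlgebra k X →ₙₐ[k] A where
  toFun c := Quot.liftOn c (FreeNonUnitalNonAssocAlgebra.lift k f) (lift_spec f)
  map_smul' := by rintro t ⟨a⟩; exact map_smul (FreeNonUnitalNonAssocAlgebra.lift k f) t a
  map_zero' := map_zero (FreeNonUnitalNonAssocAlgebra.lift k f)
  map_add' := by rintro ⟨a⟩ ⟨b⟩; exact map_add (FreeNonUnitalNonAssocAlgebra.lift k f) a b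
  map_mul' := by rintro ⟨a⟩ ⟨b⟩; exact map_mul (FreeNonUnitalNonAssocAlgebra.lift k f) a b

/-- The universal property: existence. -/
theorem lift_of (f : X → A) (x : X) : lift k f (of k x) = f x :=
  congrFun (FreeNonUnitalNonAssocAlgebra.of_comp_lift k f) x

/-- The universal property: uniqueness. -/
theorem hom_ext {f g : FreeLeibnizAlgebra k X →ₙₐ[k] A} (h : ∀ x, f (of k x) = g (of k x)) :
    f = g := by
  have h1 : f.comp mk = g.comp mk :=
    (FreeNonUnitalNonAssocAlgebra.lift k).symm.injective (funext h)
  ext ⟨a⟩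
  exact DFunLike.congr_fun h1 a

end FreeLeibnizAlgebra

/-- The Leibniz algebra `A` is free on the family `ι : X → A`: the canonical homomorphism from
the free Leibniz algebra on `X` to `A` is an isomorphism. -/
def IsFreeLeibnizOn {X : Type v} {A : Type w} [LeibnizRing A] [LeibnizAlgebra k A]
    (ι : X → A) : Prop :=
  Function.Bijective (FreeLeibnizAlgebra.lift k ι)

end Free

/-! ### Products of subspaces, derived algebra, center -/

section Subspaces

variable (k : Type*) [Field k] {L : Type*} [LeibnizRing L] [LeibnizAlgebra k L]

/-- The subspace `AB` spanned by all products `ab` with `a ∈ A` and `b ∈ B`. -/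
def leibnizProd (A B : Submodule k L) : Submodule k L :=
  Submodule.span k {z | ∃ a ∈ A, ∃ b ∈ B, a * b = z}

variable (L) in
/-- The derived algebra `L' = LL`. -/
def leibnizDerived : Submodule k L := leibnizProd k ⊤ ⊤

variable (L) in
/-- The (two-sided) center of `L`. -/
def leibnizCenter : Submodule k L where
  carrier := {z | ∀ x : L, z * x = 0 ∧ x * z = 0}
  zero_mem' := fun x => ⟨zero_mul x, mul_zero x⟩
  add_mem' := fun {a b} ha hb x => by simp [add_mul, mul_add, ha x, hb x]
  smul_mem' := fun t a ha x => by simp [smul_mul_assoc, mul_smul_comm, ha x]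

variable {E : Type*} [LeibnizRing E] [LeibnizAlgebra k E]

/-- The kernel of a homomorphism of Leibniz algebras, as a subspace. -/
def leibnizKer (π : E →ₙₐ[k] L) : Submodule k E := LinearMap.ker (π : E →ₗ[k] L)

/-- For a homomorphism `π : F → L` with kernel `R`, the subspace `FR + RF` of `F`. -/
def leibnizRelProd (π : E →ₙₐ[k] L) : Submodule k E :=
  leibnizProd k ⊤ (leibnizKer k π) ⊔ leibnizProd k (leibnizKer k π) ⊤

/-- For a homomorphism `π : F → L` with kernel `R`, the quotient `(F' ∩ R) / (FR + RF)`. -/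
abbrev HopfQuotient (π : E →ₙₐ[k] L) : Type _ :=
  ↥(leibnizDerived k E ⊓ leibnizKer k π) ⧸
    (leibnizRelProd k π).submoduleOf (leibnizDerived k E ⊓ leibnizKer k π)

/-- `FR + RF` is contained in `F' ∩ R`. -/
theorem leibnizRelProd_le (π : E →ₙₐ[k] L) :
    leibnizRelProd k π ≤ leibnizDerived k E ⊓ leibnizKer k π := by
  refine sup_le (le_inf ?_ ?_) (le_inf ?_ ?_)
  all_goals
    refine Submodule.span_le.2 ?_
    rintro _ ⟨a, ha, b, hb, rfl⟩
  · exact Submodule.subset_span ⟨a, trivial, b, trivial, rfl⟩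
  · have hb' : π b = 0 := hb
    change π (a * b) = 0
    rw [map_mul, hb', mul_zero]
  · exact Submodule.subset_span ⟨a, trivial, b, trivial, rfl⟩
  · have ha' : π a = 0 := ha
    change π (a * b) = 0
    rw [map_mul, ha', zero_mul]

end Subspaces

/-! ### Second cohomology with central coefficients -/

section Cohomology

variable (k : Type*) [Field k] (L : Type*) [LeibnizRing L] [LeibnizAlgebra k L]
  (A : Type*) [AddCommGroup A] [Module k A]

/-- The space `Z²(L, A)` of 2-cocycles with values in the central `L`-module `A` (both actions
of `L` are zero): bilinear `f : L × L → A` with `f(x, yz) = f(xy, z) + f(y, xz)`. -/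
def leibnizCocycles : Submodule k (L →ₗ[k] L →ₗ[k] A) where
  carrier := {f | ∀ x y z : L, f x (y * z) = f (x * y) z + f y (x * z)}
  zero_mem' := fun x y z => by simp
  add_mem' := fun {f g} hf hg x y z => by
    simp only [LinearMap.add_apply, hf x y z, hg x y z]; abel
  smul_mem' := fun t f hf x y z => by
    simp only [LinearMap.smul_apply, hf x y z, smul_add]

/-- The space `B²(L, A)` of 2-coboundaries: the 2-cocycles of the form
`(x, y) ↦ -ε(xy)` with `ε : L → A` linear. -/
def leibnizCoboundaries : Submodule k (leibnizCocycles k L A) where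
  carrier := {f | ∃ ε : L →ₗ[k] A, ∀ x y : L, f.1 x y = -ε (x * y)}
  zero_mem' := ⟨0, fun x y => by simp⟩
  add_mem' := by
    rintro f g ⟨ε, hε⟩ ⟨η, hη⟩
    refine ⟨ε + η, fun x y => ?_⟩
    simp only [Submodule.coe_add, LinearMap.add_apply, hε, hη]; abel
  smul_mem' := by
    rintro t f ⟨ε, hε⟩
    exact ⟨t • ε, fun x y => by simp [hε]⟩

/-- The second cohomology `H²(L, A) = Z²(L, A) / B²(L, A)`. -/
abbrev LeibnizH2 : Type _ := leibnizCocycles k L A ⧸ leibnizCoboundaries k L A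

end Cohomology

/-! ### Defining pairs, covers and multipliers -/

section Multiplier

universe u v w

variable (k : Type u) [Field k] (L : Type v) [LeibnizRing L] [LeibnizAlgebra k L]

/-- `(K, M)` is a defining pair for `L`: `L ≅ K/M` and `M ⊆ Z(K) ∩ K'`. The isomorphism `K/M ≅ L`
is given as a surjective homomorphism `K → L` with kernel `M`. -/
def IsDefiningPair (K : Type w) [LeibnizRing K] [LeibnizAlgebra k K] (M : Submodule k K) : Prop :=
  (∃ p : K →ₙₐ[k] L, Function.Surjective p ∧ leibnizKer k p = M) ∧
    M ≤ leibnizCenter k K ⊓ leibnizDerived k K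

/-- `(K, M)` is a maximal defining pair for `L`: the dimension of `K` is the largest possible
(so `K` is a cover of `L` and `M` is the multiplier of `L`). -/
def IsMaximalDefiningPair (K : Type w) [LeibnizRing K] [LeibnizAlgebra k K]
    (M : Submodule k K) : Prop :=
  IsDefiningPair k L K M ∧
    ∀ (J : Type w) [LeibnizRing J] [LeibnizAlgebra k J] (N : Submodule k J),
      IsDefiningPair k L J N → Module.rank k J ≤ Module.rank k K

end Multiplier

universe u v w x

/-! Take a linear section `s` of `π : E → L` with kernel `R`. A functional `θ` killing `ER + RE`
gives the 2-cocycle `θ (s x * s y)`. Its class is zero exactly when `θ` vanishes on `E' ∩ R`, that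
is, when `θ` restricts to zero on `D = (E' ∩ R)/(ER + RE)`. Since functionals extend, the dual of
`D` embeds into `H²` for every extension (`exists_dual_hopfQuotient_injective`). If `E` is free, `π`
lifts to the central extension attached to any cocycle, so every cocycle arises and the embedding is
an isomorphism (`IsFreeLeibnizOn.nonempty_leibnizH2_equiv`).

For a defining pair, `D` is `M` itself, so `dim M ≤ dim H²` when `L` is finite-dimensional. The
central extension by a universal cocycle with values in the dual of `H²` attains this bound
(`ker_fst_le_leibnizDerived_cover`), and `dim K = dim L + dim M` gives the rest. -/

/-! ### Central extensions by cocycles -/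

section CentralExtension

/-- The central extension of `L` by `A` defined by a 2-cocycle. -/
def LeibnizCentralExtension {k : Type*} [Field k] {L : Type*} [LeibnizRing L] [LeibnizAlgebra k L]
    {A : Type*} [AddCommGroup A] [Module k A] (_g : leibnizCocycles k L A) : Type _ :=
  L × A

variable {k : Type*} [Field k] {L : Type*} [LeibnizRing L] [LeibnizAlgebra k L]
  {A : Type*} [AddCommGroup A] [Module k A] (g : leibnizCocycles k L A)

namespace LeibnizCentralExtension

instance : AddCommGroup (LeibnizCentralExtension g) := inferInstanceAs (AddCommGroup (L × A))

instance : Module k (LeibnizCentralExtension g) := inferInstanceAs (Module k (L × A))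

instance : Mul (LeibnizCentralExtension g) where
  mul a b := (a.1 * b.1, g.1 a.1 b.1)

variable {g}

@[ext]
theorem ext {a b : LeibnizCentralExtension g} (h₁ : a.1 = b.1) (h₂ : a.2 = b.2) : a = b :=
  Prod.ext h₁ h₂

@[simp] theorem fst_add (a b : LeibnizCentralExtension g) : (a + b).1 = a.1 + b.1 := rfl

@[simp] theorem snd_add (a b : LeibnizCentralExtension g) : (a + b).2 = a.2 + b.2 := rfl

@[simp] theorem fst_zero : (0 : LeibnizCentralExtension g).1 = 0 := rfl

@[simp] theorem snd_zero : (0 : LeibnizCentralExtension g).2 = 0 := rfl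

@[simp] theorem fst_smul (t : k) (a : LeibnizCentralExtension g) : (t • a).1 = t • a.1 := rfl

@[simp] theorem snd_smul (t : k) (a : LeibnizCentralExtension g) : (t • a).2 = t • a.2 := rfl

@[simp] theorem fst_mul (a b : LeibnizCentralExtension g) : (a * b).1 = a.1 * b.1 := rfl

@[simp] theorem snd_mul (a b : LeibnizCentralExtension g) : (a * b).2 = g.1 a.1 b.1 := rfl

variable (g)

instance : LeibnizRing (LeibnizCentralExtension g) where
  left_distrib a b c := by ext <;> simp [mul_add]
  right_distrib a b c := by ext <;> simp [add_mul]
  zero_mul a := by ext <;> simp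
  mul_zero a := by ext <;> simp
  leibniz a b c := by
    ext
    · exact LeibnizRing.leibniz a.1 b.1 c.1
    · exact g.2 a.1 b.1 c.1

instance : LeibnizAlgebra k (LeibnizCentralExtension g) where
  smul_assoc t a b := by
    change (t • a) * b = t • (a * b)
    ext <;> simp [smul_mul_assoc]
  smul_comm t a b := by
    change t • (a * b) = a * (t • b)
    ext <;> simp [mul_smul_comm]

/-- The projection of a central extension of `L` onto `L`. -/
def fst : LeibnizCentralExtension g →ₙₐ[k] L where
  toFun a := a.1
  map_smul' _ _ := rfl
  map_zero' := rfl
  map_add' _ _ := rfl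
  map_mul' _ _ := rfl

/-- The second coordinate of a central extension, as a linear map. -/
def snd : LeibnizCentralExtension g →ₗ[k] A := LinearMap.snd k L A

/-- The inclusion of the kernel of a central extension. -/
def inr : A →ₗ[k] LeibnizCentralExtension g := LinearMap.inr k L A

/-- The linear section `x ↦ (x, 0)` of a central extension of `L`. -/
def inl : L →ₗ[k] LeibnizCentralExtension g := LinearMap.inl k L A

theorem inl_add_inr (x : L) (a : A) : inl g x + inr g a = (x, a) :=
  Prod.ext (add_zero x) (zero_add a)

theorem fst_surjective : Function.Surjective (fst g) := fun x => ⟨(x, 0), rfl⟩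

theorem ker_fst : leibnizKer k (fst g) = LinearMap.range (inr g) := by
  ext a
  constructor
  · intro h
    exact ⟨a.2, Prod.ext (Eq.symm h) rfl⟩
  · rintro ⟨b, rfl⟩
    rfl

theorem ker_fst_le_center : leibnizKer k (fst g) ≤ leibnizCenter k (LeibnizCentralExtension g) := by
  intro a h b
  have h' : a.1 = 0 := h
  constructor <;> ext <;> simp [h']

end LeibnizCentralExtension

end CentralExtension

/-! ### The transgression -/

section Transgression

variable {k : Type*} [Field k] {L : Type*} [LeibnizRing L] [LeibnizAlgebra k L]
  {E : Type*} [LeibnizRing E] [LeibnizAlgebra k E]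

theorem mul_mem_leibnizDerived (a b : E) : a * b ∈ leibnizDerived k E :=
  Submodule.subset_span ⟨a, trivial, b, trivial, rfl⟩

theorem eqOn_leibnizDerived {V : Type*} [AddCommGroup V] [Module k V] {θ η : E →ₗ[k] V}
    (h : ∀ a b : E, θ (a * b) = η (a * b)) {c : E} (hc : c ∈ leibnizDerived k E) : θ c = η c := by
  refine LinearMap.eqOn_span (f := θ) (g := η) ?_ hc
  rintro _ ⟨a, -, b, -, rfl⟩
  exact h a b

variable (π : E →ₙₐ[k] L)

theorem mul_mem_leibnizRelProd_left {r : E} (hr : π r = 0) (a : E) :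
    r * a ∈ leibnizRelProd k π :=
  Submodule.mem_sup_right (Submodule.subset_span ⟨r, hr, a, trivial, rfl⟩)

theorem mul_mem_leibnizRelProd_right {r : E} (hr : π r = 0) (a : E) :
    a * r ∈ leibnizRelProd k π :=
  Submodule.mem_sup_left (Submodule.subset_span ⟨a, trivial, r, hr, rfl⟩)

theorem exists_linear_section {π : E →ₙₐ[k] L} (hπ : Function.Surjective π) :
    ∃ s : L →ₗ[k] E, ∀ x, π (s x) = x := by
  obtain ⟨s, hs⟩ := LinearMap.exists_rightInverse_of_surjective (π : E →ₗ[k] L)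
    (LinearMap.range_eq_top.2 hπ)
  exact ⟨s, fun x => LinearMap.congr_fun hs x⟩

-- Since `a * b - c * d = (a - c) * b + c * (b - d)` lies in `ER + RE`, values of `θ` on products
-- ignore the choice of preimages. The cocycle identity thus reduces to the Leibniz identity in `E`.
variable {π} in
theorem dualAnnihilator_mul_eq {θ : Module.Dual k E}
    (hθ : θ ∈ (leibnizRelProd k π).dualAnnihilator) {a b c d : E} (h₁ : π a = π c)
    (h₂ : π b = π d) : θ (a * b) = θ (c * d) := by
  rw [Submodule.mem_dualAnnihilator] at hθ
  have e : a * b - c * d = (a - c) * b + c * (b - d) := by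
    rw [sub_mul, mul_sub]; abel
  rw [← sub_eq_zero, ← map_sub, e, map_add,
    hθ _ (mul_mem_leibnizRelProd_left π (by rw [map_sub, h₁, sub_self]) b),
    hθ _ (mul_mem_leibnizRelProd_right π (by rw [map_sub, h₂, sub_self]) c), add_zero]

/-- Functionals on `E` which kill `ER + RE`, where `R` is the kernel of `π : E → L`, induce
2-cocycles on `L`. -/
def leibnizTransgression (s : L →ₗ[k] E) (hs : ∀ x, π (s x) = x) :
    (leibnizRelProd k π).dualAnnihilator →ₗ[k] leibnizCocycles k L k where
  toFun θ := ⟨((LinearMap.mul k E).compl₁₂ s s).compr₂ θ.1, fun x y z => by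
    change θ.1 (s x * s (y * z)) = θ.1 (s (x * y) * s z) + θ.1 (s y * s (x * z))
    have e (a b : L) : π (s (a * b)) = π (s a * s b) := by simp only [map_mul, hs]
    rw [dualAnnihilator_mul_eq θ.2 rfl (e y z), dualAnnihilator_mul_eq θ.2 (e x y) rfl,
      dualAnnihilator_mul_eq θ.2 rfl (e x z), ← map_add, ← LeibnizRing.leibniz]⟩
  map_add' _ _ := rfl
  map_smul' _ _ := rfl

theorem leibnizTransgression_apply (s : L →ₗ[k] E) (hs : ∀ x, π (s x) = x)
    (θ : (leibnizRelProd k π).dualAnnihilator) (a b : E) :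
    (leibnizTransgression π s hs θ).1 (π a) (π b) = θ.1 (a * b) :=
  dualAnnihilator_mul_eq θ.2 (hs _) (hs _)

/-- Restriction of functionals on `E` to `(E' ∩ R) / (ER + RE)`. -/
def hopfRestrict : (leibnizRelProd k π).dualAnnihilator →ₗ[k] Module.Dual k (HopfQuotient k π) where
  toFun θ := Submodule.liftQ _ (θ.1 ∘ₗ Submodule.subtype _) fun a ha =>
    (Submodule.mem_dualAnnihilator _).1 θ.2 _ ha
  map_add' _ _ := by ext; rfl
  map_smul' _ _ := by ext; rfl

theorem hopfRestrict_surjective : Function.Surjective (hopfRestrict π) := by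
  intro φ
  obtain ⟨θ, hθ⟩ := LinearMap.exists_extend (φ ∘ₗ Submodule.mkQ _)
  refine ⟨⟨θ, (Submodule.mem_dualAnnihilator _).2 fun a ha => ?_⟩, ?_⟩
  · have h := LinearMap.congr_fun hθ ⟨a, leibnizRelProd_le k π ha⟩
    refine h.trans ?_
    rw [LinearMap.comp_apply, Submodule.mkQ_apply, (Submodule.Quotient.mk_eq_zero _).2, map_zero]
    exact ha
  · ext a
    exact LinearMap.congr_fun hθ a

theorem mem_ker_hopfRestrict (θ : (leibnizRelProd k π).dualAnnihilator) :
    θ ∈ LinearMap.ker (hopfRestrict π) ↔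
      ∀ a ∈ leibnizDerived k E ⊓ leibnizKer k π, θ.1 a = 0 := by
  rw [LinearMap.mem_ker]
  constructor
  · intro h a ha
    exact LinearMap.congr_fun h (Submodule.Quotient.mk ⟨a, ha⟩)
  · intro h
    ext a
    exact h a.1 a.2

/-- A coboundary means that `θ` agrees on `E'` with `-ε ∘ π`, which vanishes on `R`. Conversely, if
`θ` vanishes on `E' ∩ R`, its restriction to `E'` factors through `π(E')`, and the factor extends to
`L`. -/
theorem leibnizTransgression_mem_coboundaries (s : L →ₗ[k] E) (hs : ∀ x, π (s x) = x)
    (θ : (leibnizRelProd k π).dualAnnihilator) :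
    leibnizTransgression π s hs θ ∈ leibnizCoboundaries k L k ↔
      ∀ a ∈ leibnizDerived k E ⊓ leibnizKer k π, θ.1 a = 0 := by
  constructor
  · rintro ⟨ε, hε⟩ a ⟨ha, ha'⟩
    have h : θ.1 a = (-(ε ∘ₗ (π : E →ₗ[k] L))) a := by
      refine eqOn_leibnizDerived (fun b c => ?_) ha
      rw [← leibnizTransgression_apply π s hs, hε, ← map_mul]
      rfl
    have ha'' : π a = 0 := ha'
    rw [h]
    change -ε (π a) = 0
    rw [ha'', map_zero, neg_zero]
  · intro h
    let p : ↥(leibnizDerived k E) →ₗ[k] L := (π : E →ₗ[k] L) ∘ₗ Submodule.subtype _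
    let q : ↥(leibnizDerived k E) →ₗ[k] k := θ.1 ∘ₗ Submodule.subtype _
    have hpq : LinearMap.ker p ≤ LinearMap.ker q := fun a ha => h a.1 ⟨a.2, ha⟩
    obtain ⟨ε, hε⟩ := LinearMap.exists_extend
      ((LinearMap.ker p).liftQ q hpq ∘ₗ p.quotKerEquivRange.symm.toLinearMap)
    have hε' (a : ↥(leibnizDerived k E)) : ε (p a) = q a := by
      have h₁ := LinearMap.congr_fun hε (p.quotKerEquivRange (Submodule.Quotient.mk a))
      simpa using h₁
    refine ⟨-ε, fun x y => ?_⟩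
    have h₂ := hε' ⟨s x * s y, mul_mem_leibnizDerived _ _⟩
    change ε (π (s x * s y)) = θ.1 (s x * s y) at h₂
    rw [map_mul, hs, hs] at h₂
    rw [LinearMap.neg_apply, neg_neg, h₂]
    rfl

theorem ker_mkQ_comp_leibnizTransgression (s : L →ₗ[k] E) (hs : ∀ x, π (s x) = x) :
    LinearMap.ker ((leibnizCoboundaries k L k).mkQ ∘ₗ leibnizTransgression π s hs) =
      LinearMap.ker (hopfRestrict π) := by
  ext θ
  rw [mem_ker_hopfRestrict, ← leibnizTransgression_mem_coboundaries π s hs θ, LinearMap.mem_ker,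
    LinearMap.comp_apply, Submodule.mkQ_apply, Submodule.Quotient.mk_eq_zero]

/-- For an extension `0 → R → E → L → 0`, the dual of `(E' ∩ R) / (ER + RE)` embeds into the
second cohomology of `L`. -/
theorem exists_dual_hopfQuotient_injective {π : E →ₙₐ[k] L} (hπ : Function.Surjective π) :
    ∃ T : Module.Dual k (HopfQuotient k π) →ₗ[k] LeibnizH2 k L k, Function.Injective T := by
  obtain ⟨s, hs⟩ := exists_linear_section hπ
  let q := (leibnizCoboundaries k L k).mkQ ∘ₗ leibnizTransgression π s hs
  have hq : LinearMap.ker q = LinearMap.ker (hopfRestrict π) :=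
    ker_mkQ_comp_leibnizTransgression π s hs
  let e := LinearMap.quotKerEquivOfSurjective (hopfRestrict π) (hopfRestrict_surjective π)
  -- One inclusion of kernels makes the map well defined, the other makes it injective.
  refine ⟨(LinearMap.ker (hopfRestrict π)).liftQ q hq.ge ∘ₗ e.symm.toLinearMap, ?_⟩
  have hinj : Function.Injective ((LinearMap.ker (hopfRestrict π)).liftQ q hq.ge) :=
    LinearMap.ker_eq_bot.1 (Submodule.ker_liftQ_eq_bot _ _ _ hq.le)
  exact hinj.comp e.symm.injective

variable {X : Type*} {ι : X → E}

/-- A homomorphism from a free Leibniz algebra onto `L` lifts to any central extension of `L`. -/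
theorem IsFreeLeibnizOn.exists_pullback_eq (hE : IsFreeLeibnizOn k ι) {A : Type*}
    [AddCommGroup A] [Module k A] (g : leibnizCocycles k L A) :
    ∃ θ : E →ₗ[k] A, ∀ a b : E, θ (a * b) = g.1 (π a) (π b) := by
  let l := FreeLeibnizAlgebra.lift k ι
  let φ : FreeLeibnizAlgebra k X →ₙₐ[k] LeibnizCentralExtension g :=
    -- The second coordinate 0 is arbitrary: any lift of the generators would do.
    FreeLeibnizAlgebra.lift k fun x => (π (ι x), 0)
  have hφ : (LeibnizCentralExtension.fst g).comp φ = π.comp l := by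
    refine FreeLeibnizAlgebra.hom_ext fun x => ?_
    rw [NonUnitalAlgHom.comp_apply, NonUnitalAlgHom.comp_apply]
    refine (congrArg (LeibnizCentralExtension.fst g) (FreeLeibnizAlgebra.lift_of _ x)).trans ?_
    exact (congrArg π (FreeLeibnizAlgebra.lift_of ι x)).symm
  let e : FreeLeibnizAlgebra k X ≃ₗ[k] E :=
    LinearEquiv.ofBijective (l : FreeLeibnizAlgebra k X →ₗ[k] E) hE
  -- The second coordinate of the lift is `θ`; the required formula is multiplicativity of the lift
  -- read in that coordinate.
  refine ⟨LeibnizCentralExtension.snd g ∘ₗ (φ : _ →ₗ[k] LeibnizCentralExtension g) ∘ₗ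
    e.symm.toLinearMap, fun a b => ?_⟩
  obtain ⟨a, rfl⟩ := hE.2 a
  obtain ⟨b, rfl⟩ := hE.2 b
  have h₁ : e.symm (l a * l b) = a * b := by
    rw [← map_mul]
    exact e.symm_apply_apply (a * b)
  change (φ (e.symm (l a * l b))).2 = g.1 (π (l a)) (π (l b))
  rw [h₁, map_mul, LeibnizCentralExtension.snd_mul]
  have h₂ (c) : (φ c).1 = π (l c) := DFunLike.congr_fun hφ c
  rw [h₂, h₂]

theorem IsFreeLeibnizOn.leibnizTransgression_surjective (hE : IsFreeLeibnizOn k ι)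
    (s : L →ₗ[k] E) (hs : ∀ x, π (s x) = x) :
    Function.Surjective (leibnizTransgression π s hs) := by
  intro g
  obtain ⟨θ, hθ⟩ := hE.exists_pullback_eq π g
  have hR : leibnizRelProd k π ≤ LinearMap.ker θ := by
    refine sup_le (Submodule.span_le.2 ?_) (Submodule.span_le.2 ?_)
    · rintro _ ⟨a, -, b, hb, rfl⟩
      have hb' : π b = 0 := hb
      exact (hθ a b).trans (by rw [hb', map_zero])
    · rintro _ ⟨a, ha, b, -, rfl⟩
      have ha' : π a = 0 := ha
      exact (hθ a b).trans (by rw [ha', map_zero, LinearMap.zero_apply])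
  refine ⟨⟨θ, (Submodule.mem_dualAnnihilator _).2 fun a ha => hR ha⟩, ?_⟩
  ext x y
  exact (hθ (s x) (s y)).trans (by rw [hs, hs])

/-- The dual Hopf formula. -/
theorem IsFreeLeibnizOn.nonempty_leibnizH2_equiv (hE : IsFreeLeibnizOn k ι)
    (hπ : Function.Surjective π) :
    Nonempty (LeibnizH2 k L k ≃ₗ[k] Module.Dual k (HopfQuotient k π)) := by
  obtain ⟨s, hs⟩ := exists_linear_section hπ
  exact ⟨(LinearMap.quotKerEquivOfSurjective
    ((leibnizCoboundaries k L k).mkQ ∘ₗ leibnizTransgression π s hs)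
    ((Submodule.mkQ_surjective _).comp (hE.leibnizTransgression_surjective π s hs))).symm ≪≫ₗ
    Submodule.quotEquivOfEq _ _ (ker_mkQ_comp_leibnizTransgression π s hs) ≪≫ₗ
    LinearMap.quotKerEquivOfSurjective _ (hopfRestrict_surjective π)⟩

theorem nonempty_dual_equiv (V : Type*) [AddCommGroup V] [Module k V] [FiniteDimensional k V] :
    Nonempty (Module.Dual k V ≃ₗ[k] V) :=
  ⟨LinearEquiv.ofFinrankEq _ _ Subspace.dual_finrank_eq⟩

end Transgression

/-! ### Defining pairs -/

section DefiningPair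

variable {k : Type*} [Field k] {L : Type*} [LeibnizRing L] [LeibnizAlgebra k L]

theorem leibnizRelProd_eq_bot {E : Type*} [LeibnizRing E] [LeibnizAlgebra k E] {π : E →ₙₐ[k] L}
    (h : leibnizKer k π ≤ leibnizCenter k E) : leibnizRelProd k π = ⊥ := by
  refine le_bot_iff.1 (sup_le (Submodule.span_le.2 ?_) (Submodule.span_le.2 ?_))
  · rintro _ ⟨a, -, b, hb, rfl⟩
    exact (h hb a).2
  · rintro _ ⟨a, ha, b, -, rfl⟩
    exact (h ha b).1

namespace IsDefiningPair

variable {K : Type*} [LeibnizRing K] [LeibnizAlgebra k K] {M : Submodule k K}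

/-- Centrality of `M` makes the denominator zero, and `M ≤ K'` makes the numerator `M`. -/
theorem nonempty_hopfQuotient_equiv {p : K →ₙₐ[k] L} (hp : leibnizKer k p = M)
    (hM : M ≤ leibnizCenter k K ⊓ leibnizDerived k K) : Nonempty (HopfQuotient k p ≃ₗ[k] M) := by
  subst hp
  have h₁ : (leibnizRelProd k p).submoduleOf (leibnizDerived k K ⊓ leibnizKer k p) = ⊥ := by
    rw [leibnizRelProd_eq_bot (hM.trans inf_le_left)]
    exact Submodule.ker_subtype _
  exact ⟨Submodule.quotEquivOfEqBot _ h₁ ≪≫ₗ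
    LinearEquiv.ofEq _ _ (inf_eq_right.2 (hM.trans inf_le_right))⟩

theorem exists_dual_injective (h : IsDefiningPair k L K M) :
    ∃ T : Module.Dual k M →ₗ[k] LeibnizH2 k L k, Function.Injective T := by
  obtain ⟨⟨p, hp, hpM⟩, hM⟩ := h
  obtain ⟨e⟩ := nonempty_hopfQuotient_equiv hpM hM
  obtain ⟨T, hT⟩ := exists_dual_hopfQuotient_injective hp
  exact ⟨T ∘ₗ e.dualMap.toLinearMap, hT.comp e.dualMap.injective⟩

variable [FiniteDimensional k L]

theorem finiteDimensional_submodule (h : IsDefiningPair k L K M) : FiniteDimensional k M := by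
  obtain ⟨T, hT⟩ := h.exists_dual_injective
  have := FiniteDimensional.of_injective T hT
  exact Module.finite_dual_iff k |>.1 this

theorem finrank_submodule_le (h : IsDefiningPair k L K M) :
    Module.finrank k M ≤ Module.finrank k (LeibnizH2 k L k) := by
  obtain ⟨T, hT⟩ := h.exists_dual_injective
  rw [← Subspace.dual_finrank_eq (K := k) (V := M)]
  exact LinearMap.finrank_le_finrank_of_injective hT

theorem finiteDimensional (h : IsDefiningPair k L K M) : FiniteDimensional k K := by
  have := h.finiteDimensional_submodule
  obtain ⟨⟨p, hp, rfl⟩, hM⟩ := h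
  have e := (p : K →ₗ[k] L).quotKerEquivOfSurjective hp
  have : FiniteDimensional k (K ⧸ leibnizKer k p) := Module.Finite.equiv e.symm
  exact Module.Finite.of_submodule_quotient (leibnizKer k p)

theorem finrank_eq (h : IsDefiningPair k L K M) :
    Module.finrank k K = Module.finrank k L + Module.finrank k M := by
  have := h.finiteDimensional
  obtain ⟨⟨p, hp, rfl⟩, hM⟩ := h
  rw [← LinearMap.finrank_range_add_finrank_ker (p : K →ₗ[k] L),
    LinearMap.range_eq_top.2 hp, finrank_top]
  rfl

end IsDefiningPair

end DefiningPair

/-! ### The cover -/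

section Cover

variable (k : Type*) [Field k] (L : Type*) [LeibnizRing L] [LeibnizAlgebra k L]

/-- A linear choice of representatives of cohomology classes. -/
noncomputable def leibnizRepr : LeibnizH2 k L k →ₗ[k] leibnizCocycles k L k :=
  ((leibnizCoboundaries k L k).mkQ.exists_rightInverse_of_surjective
    (Submodule.range_mkQ _)).choose

variable {k L} in
theorem mk_leibnizRepr (h : LeibnizH2 k L k) :
    (leibnizCoboundaries k L k).mkQ (leibnizRepr k L h) = h :=
  LinearMap.congr_fun ((leibnizCoboundaries k L k).mkQ.exists_rightInverse_of_surjective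
    (Submodule.range_mkQ _)).choose_spec h

/-- The universal cocycle, with values in the dual of the second cohomology. -/
noncomputable def leibnizUniversalCocycle : leibnizCocycles k L (Module.Dual k (LeibnizH2 k L k)) :=
  ⟨LinearMap.mk₂ k
    -- A pair `(x, y)` goes to evaluation at `(x, y)` of the chosen representative, which is linear
    -- in the class because the choice is linear.
    (fun x y => LinearMap.applyₗ y ∘ₗ LinearMap.applyₗ x ∘ₗ Submodule.subtype _ ∘ₗ leibnizRepr k L)
    (fun _ _ _ => by ext; simp) (fun _ _ _ => by ext; simp)
    (fun _ _ _ => by ext; simp) (fun _ _ _ => by ext; simp), fun x y z => by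
    refine LinearMap.ext fun h => ?_
    exact (leibnizRepr k L h).2 x y z⟩

theorem leibnizUniversalCocycle_apply (x y : L) (h : LeibnizH2 k L k) :
    (leibnizUniversalCocycle k L).1 x y h = (leibnizRepr k L h).1 x y := rfl

/-- The central extension of `L` defined by the universal cocycle. -/
abbrev LeibnizCover : Type _ := LeibnizCentralExtension (leibnizUniversalCocycle k L)

open LeibnizCentralExtension

variable [FiniteDimensional k L]

/-- Otherwise some functional `ψ` kills the derived algebra but not the kernel. On the kernel `ψ` is
evaluation at a class `h`, and its vanishing on products exhibits the representative of `h` as the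
coboundary of `ψ ∘ inl`. Then `h = 0`, so `ψ` kills the kernel after all. -/
theorem ker_fst_le_leibnizDerived_cover :
    leibnizKer k (fst (leibnizUniversalCocycle k L)) ≤ leibnizDerived k (LeibnizCover k L) := by
  rw [ker_fst]
  rintro _ ⟨a, rfl⟩
  by_contra hna
  obtain ⟨ψ, hψ, hψa⟩ := Submodule.exists_le_ker_of_notMem hna
  let g := leibnizUniversalCocycle k L
  -- Biduality, available because `H²` is finite-dimensional.
  obtain ⟨h, hh⟩ := (Module.evalEquiv k (LeibnizH2 k L k)).surjective (ψ ∘ₗ inr g)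
  have hψr (b : Module.Dual k (LeibnizH2 k L k)) : ψ (inr g b) = b h :=
    (LinearMap.congr_fun hh b).symm
  have hcob : leibnizRepr k L h ∈ leibnizCoboundaries k L k := by
    refine ⟨ψ ∘ₗ inl g, fun x y => ?_⟩
    have h₀ : ψ (inl g x * inl g y) = 0 := hψa (mul_mem_leibnizDerived _ _)
    have h₁ : inl g x * inl g y = inl g (x * y) + inr g (g.1 x y) := (inl_add_inr g _ _).symm
    rw [h₁, map_add, hψr, leibnizUniversalCocycle_apply] at h₀
    exact eq_neg_of_add_eq_zero_right h₀
  have hzero : h = 0 := by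
    rw [← mk_leibnizRepr h, Submodule.mkQ_apply, Submodule.Quotient.mk_eq_zero]
    exact hcob
  exact hψ (by rw [hψr, hzero, map_zero])

theorem isDefiningPair_cover :
    IsDefiningPair k L (LeibnizCover k L) (leibnizKer k (fst (leibnizUniversalCocycle k L))) :=
  ⟨⟨_, fst_surjective _, rfl⟩,
    le_inf (ker_fst_le_center _) (ker_fst_le_leibnizDerived_cover k L)⟩

theorem finrank_cover :
    Module.finrank k (LeibnizCover k L) =
      Module.finrank k L + Module.finrank k (LeibnizH2 k L k) := by
  rw [← Subspace.dual_finrank_eq (K := k) (V := LeibnizH2 k L k)]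
  exact Module.finrank_prod

end Cover

/-! ### Maximality of the cover and the main theorem -/

section MaximalDefiningPair

variable (k : Type u) [Field k] (L : Type v) [LeibnizRing L] [LeibnizAlgebra k L]
  [FiniteDimensional k L]

theorem isMaximalDefiningPair_cover :
    IsMaximalDefiningPair k L (LeibnizCover k L)
      (leibnizKer k (LeibnizCentralExtension.fst (leibnizUniversalCocycle k L))) := by
  refine ⟨isDefiningPair_cover k L, fun J _ _ N hJ => ?_⟩
  have := hJ.finiteDimensional
  have := (isDefiningPair_cover k L).finiteDimensional
  rw [← Module.finrank_eq_rank, ← Module.finrank_eq_rank, Nat.cast_le, finrank_cover,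
    hJ.finrank_eq]
  exact Nat.add_le_add_left hJ.finrank_submodule_le _

variable {k L}

/-- Comparison with the cover forces `dim M ≥ dim H²`. Maximality is tested within one universe, and
`max u v` is where the cover lives. -/
theorem IsMaximalDefiningPair.nonempty_equiv_leibnizH2 {K : Type (max u v)} [LeibnizRing K]
    [LeibnizAlgebra k K] {M : Submodule k K} (h : IsMaximalDefiningPair k L K M) :
    Nonempty (M ≃ₗ[k] LeibnizH2 k L k) := by
  have := h.1.finiteDimensional
  have := (isDefiningPair_cover k L).finiteDimensional
  have hle := h.2 _ _ (isDefiningPair_cover k L)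
  rw [← Module.finrank_eq_rank, ← Module.finrank_eq_rank, Nat.cast_le, finrank_cover,
    h.1.finrank_eq] at hle
  exact ⟨LinearEquiv.ofFinrankEq _ _
    (le_antisymm h.1.finrank_submodule_le (Nat.le_of_add_le_add_left hle))⟩

end MaximalDefiningPair

theorem mainTheorem2 {k : Type u} [Field k]
    {L : Type v} [LeibnizRing L] [LeibnizAlgebra k L]
    {F : Type w} [LeibnizRing F] [LeibnizAlgebra k F]
    {X : Type x} (ι : X → F) (hF : IsFreeLeibnizOn k ι)
    (π : F →ₙₐ[k] L) (hπ : Function.Surjective π) :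
    Nonempty (LeibnizH2 k L k ≃ₗ[k] Module.Dual k (HopfQuotient k π)) ∧
    (FiniteDimensional k (HopfQuotient k π) →
      Nonempty (LeibnizH2 k L k ≃ₗ[k] HopfQuotient k π)) ∧
    (FiniteDimensional k L →
      Nonempty (LeibnizH2 k L k ≃ₗ[k] HopfQuotient k π) ∧
      (∃ (K : Type (max u v)) (_ : LeibnizRing K) (_ : LeibnizAlgebra k K) (M : Submodule k K),
        IsMaximalDefiningPair k L K M) ∧
      (∀ (K : Type (max u v)) [LeibnizRing K] [LeibnizAlgebra k K] (M : Submodule k K),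
        IsMaximalDefiningPair k L K M → Nonempty (M ≃ₗ[k] LeibnizH2 k L k))) := by
  obtain ⟨e⟩ := hF.nonempty_leibnizH2_equiv π hπ
  have hfin (_ : FiniteDimensional k (HopfQuotient k π)) :
      Nonempty (LeibnizH2 k L k ≃ₗ[k] HopfQuotient k π) :=
    (nonempty_dual_equiv (HopfQuotient k π)).map e.trans
  refine ⟨⟨e⟩, hfin, fun hL => ⟨hfin ?_, ?_, ?_⟩⟩
  -- `H²` is finite-dimensional because `L` is; hence so is the dual of `D`, and so is `D`.
  · exact Module.finite_dual_iff k |>.1 (Module.Finite.equiv e)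
  · exact ⟨LeibnizCover k L, inferInstance, inferInstance, _, isMaximalDefiningPair_cover k L⟩
  · intro K _ _ M h
    exact h.nonempty_equiv_leibnizH2
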